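/- Let $\mathcal A$ be a finite-dimensional C*-algebra and let $E$ be a (right) Hilbert $\mathcal A$-module, with $\mathcal A$-valued inner product $\langle\cdot,\cdot\rangle$ linear in the second variable, that is not finitely generated as an $\mathcal A$-module. Let $\mathcal L(E)$ be the Banach algebra of bounded adjointable operators on $E$, that is, of the $\mathcal A$-linear maps $T:E\to E$ for which there is $T^*:E\to E$ with $\langle Tx,y\rangle=\langle x,T^*y\rangle$ for all $x,y\in E$. Call an operator on $E$ compact if it belongs to the operator-norm closure $\mathcal K(E)$ in $\mathcal L(E)$ of the linear span of the operators $\theta_{x,y}:z\mapsto x\langle y,z\rangle$, $x,y\in E$. An invariant submodule of $T\in\mathcal L(E)$ is a closed $\mathcal A$-submodule $W\subseteq E$ with $T(W)\subseteq W$. If $S\in\mathcal L(E)$ commutes with a nonzero compact operator $K$ on $E$, then $S$ has an invariant submodule $W$ with $\{0\}\neq W\neq E$. In particular, every nonzero compact operator on $E$ has an invariant submodule $W$ with $\{0\}\neq W\neq E$. -/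

import Mathlib

open MulOpposite

/-! Right Hilbert C⋆-modules. Throughout, `A` is a C⋆-algebra (not assumed unital) and `E` is a
right Hilbert `A`-module, encoded by Mathlib's `CStarModule Aᵐᵒᵖ E`: the right action `x a` is
`op a • x`, and completeness of `E` is the separate hypothesis `CompleteSpace E`. The module laws
follow from the axioms of the inner product, see the lemmas below. -/

namespace HilbertMod

noncomputable section

section laws

variable {A : Type*} [NonUnitalCStarAlgebra A] [PartialOrder A]
  {E : Type*} [NormedAddCommGroup E] [NormedSpace ℂ E] [SMul Aᵐᵒᵖ E] [CStarModule Aᵐᵒᵖ E]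

variable (A) in
/-- The `A`-valued inner product `⟨x, y⟩` of a right Hilbert `A`-module; it is linear in the
second variable. -/
def ip (x y : E) : A := unop (inner Aᵐᵒᵖ x y)

theorem ip_add_right (x y z : E) : ip A x (y + z) = ip A x y + ip A x z := by simp [ip]

theorem ip_sub_right (x y z : E) : ip A x (y - z) = ip A x y - ip A x z := by simp [ip]

theorem ip_smul_right (c : ℂ) (x y : E) : ip A x (c • y) = c • ip A x y := by simp [ip]

theorem ip_action_right (a : A) (x y : E) : ip A x (op a • y) = ip A x y * a := by simp [ip]

theorem star_ip (x y : E) : star (ip A x y) = ip A y x :=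
  congrArg unop (CStarModule.star_inner (A := Aᵐᵒᵖ) x y)

theorem ip_add_left (x y z : E) : ip A (x + y) z = ip A x z + ip A y z := by simp [ip]

theorem ip_smul_left (c : ℂ) (x y : E) : ip A (c • x) y = star c • ip A x y := by simp [ip]

theorem ip_zero_left (x : E) : ip A 0 x = 0 := by simp [ip]

theorem ip_action_left (a : A) (x y : E) : ip A (op a • x) y = star a * ip A x y := by
  rw [← star_ip, ip_action_right, star_mul, star_ip]

theorem ip_self_nonneg (x : E) : 0 ≤ ip A x x :=
  CStarModule.inner_self_nonneg (A := Aᵐᵒᵖ) (x := x)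

theorem ip_self_eq_zero (x : E) : ip A x x = 0 ↔ x = 0 := by
  rw [← CStarModule.inner_self (A := Aᵐᵒᵖ) (x := x)]
  exact unop_eq_zero_iff _

theorem norm_eq_sqrt_norm_ip (x : E) : ‖x‖ = √‖ip A x x‖ :=
  CStarModule.norm_eq_sqrt_norm_inner_self (A := Aᵐᵒᵖ) x

variable (A) in
theorem ext_ip {x y : E} (h : ∀ z : E, ip A z x = ip A z y) : x = y := by
  rw [← sub_eq_zero, ← ip_self_eq_zero (A := A), ip_sub_right, h, sub_self]

theorem action_add (a : A) (x y : E) : op a • (x + y) = op a • x + op a • y :=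
  ext_ip A fun z => by simp only [ip_action_right, ip_add_right, add_mul]

theorem add_action (a b : A) (x : E) : op (a + b) • x = op a • x + op b • x :=
  ext_ip A fun z => by simp only [ip_action_right, ip_add_right, mul_add]

theorem mul_action (a b : A) (x : E) : op (a * b) • x = op b • op a • x :=
  ext_ip A fun z => by simp only [ip_action_right, mul_assoc]

theorem action_smul (c : ℂ) (a : A) (x : E) : op a • (c • x) = c • (op a • x) :=
  ext_ip A fun z => by simp only [ip_action_right, ip_smul_right, smul_mul_assoc]

theorem smul_action (c : ℂ) (a : A) (x : E) : op (c • a) • x = c • (op a • x) :=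
  ext_ip A fun z => by simp only [ip_action_right, ip_smul_right, mul_smul_comm]

end laws

section submodules

variable (A : Type*) {E : Type*} [NormedAddCommGroup E] [NormedSpace ℂ E] [SMul Aᵐᵒᵖ E]

/-- `W` is an `A`-submodule of `E`: a complex subspace with `W A ⊆ W`. -/
def IsASubmodule (W : Submodule ℂ E) : Prop :=
  ∀ (a : A), ∀ x ∈ W, op a • x ∈ W

variable (E) in
/-- `E` is finitely generated as an `A`-module: some finite subset of `E` is contained in no
`A`-submodule other than `E` itself. -/
def IsFinitelyGenerated : Prop :=
  ∃ s : Finset E, ∀ W : Submodule ℂ E, IsASubmodule A W → (s : Set E) ⊆ W → W = ⊤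

end submodules

section operators

variable (A : Type*) [NonUnitalCStarAlgebra A] [PartialOrder A]
  (E : Type*) [NormedAddCommGroup E] [NormedSpace ℂ E] [SMul Aᵐᵒᵖ E] [CStarModule Aᵐᵒᵖ E]

/-- The algebra `𝓛(E)` of bounded adjointable operators on `E`, with the operator norm: the
`A`-linear `T` for which there is `T'` with `⟨T x, y⟩ = ⟨x, T' y⟩`. -/
def adjointable : Subalgebra ℂ (E →L[ℂ] E) where
  carrier := {T | (∀ (a : A) (x : E), T (op a • x) = op a • T x) ∧
    ∃ T' : E → E, ∀ x y : E, ip A (T x) y = ip A x (T' y)}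
  mul_mem' := by
    rintro S T ⟨hS, S', hS'⟩ ⟨hT, T', hT'⟩
    exact ⟨fun a x => by simp [hS, hT], fun y => T' (S' y), fun x y => by simp [hS', hT']⟩
  add_mem' := by
    rintro S T ⟨hS, S', hS'⟩ ⟨hT, T', hT'⟩
    exact ⟨fun a x => by simp [hS, hT, action_add], fun y => S' y + T' y,
      fun x y => by simp [hS', hT', ip_add_left, ip_add_right]⟩
  algebraMap_mem' := by
    intro c
    refine ⟨fun a x => ?_, fun y => star c • y, fun x y => ?_⟩
    · simp only [ContinuousLinearMap.algebraMap_apply, action_smul]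
    · simp only [ContinuousLinearMap.algebraMap_apply, ip_smul_left, ip_smul_right]

variable {E}

/-- `W` is a `T`-invariant submodule: a closed `A`-submodule of `E` with `T(W) ⊆ W`. -/
def IsInvariantSubmodule (T : adjointable A E) (W : Submodule ℂ E) : Prop :=
  IsASubmodule A W ∧ IsClosed (W : Set E) ∧ ∀ x ∈ W, (T : E →L[ℂ] E) x ∈ W

theorem norm_ip_le [StarOrderedRing A] (x y : E) : ‖ip A x y‖ ≤ ‖x‖ * ‖y‖ :=
  CStarModule.norm_inner_le (A := Aᵐᵒᵖ) E

theorem norm_action_le (a : A) (x : E) : ‖op a • x‖ ≤ ‖x‖ * ‖a‖ := by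
  have h : ‖op a • x‖ ^ 2 ≤ (‖x‖ * ‖a‖) ^ 2 := by
    rw [norm_eq_sqrt_norm_ip (A := A) (op a • x), Real.sq_sqrt (norm_nonneg _), ip_action_right,
      ip_action_left, mul_pow, norm_eq_sqrt_norm_ip (A := A) x, Real.sq_sqrt (norm_nonneg _)]
    calc ‖star a * ip A x x * a‖ ≤ ‖star a‖ * ‖ip A x x‖ * ‖a‖ :=
          (norm_mul_le _ _).trans (by gcongr; exact norm_mul_le _ _)
      _ = ‖ip A x x‖ * ‖a‖ ^ 2 := by rw [norm_star]; ring
  exact le_of_sq_le_sq h (by positivity)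

variable [StarOrderedRing A]

/-- The rank one operator `θ_{x,y} : z ↦ x ⟨y, z⟩`. -/
def rankOneCLM (x y : E) : E →L[ℂ] E :=
  LinearMap.mkContinuous
    { toFun := fun z => op (ip A y z) • x
      map_add' := fun z w => by rw [ip_add_right, add_action]
      map_smul' := fun c z => by rw [ip_smul_right, smul_action, RingHom.id_apply] }
    (‖x‖ * ‖y‖) fun z => by
      calc ‖op (ip A y z) • x‖ ≤ ‖x‖ * ‖ip A y z‖ := norm_action_le A _ _
        _ ≤ ‖x‖ * (‖y‖ * ‖z‖) := by gcongr; exact norm_ip_le A y z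
        _ = ‖x‖ * ‖y‖ * ‖z‖ := by ring

theorem rankOneCLM_apply (x y z : E) : rankOneCLM A x y z = op (ip A y z) • x := rfl

/-- `θ_{x,y}` as an element of `𝓛(E)`; its adjoint is `θ_{y,x}`. -/
def rankOne (x y : E) : adjointable A E :=
  ⟨rankOneCLM A x y,
    fun a z => by rw [rankOneCLM_apply, rankOneCLM_apply, ip_action_right, mul_action],
    rankOneCLM A y x, fun z w => by
      rw [rankOneCLM_apply, rankOneCLM_apply, ip_action_left, ip_action_right, star_ip]⟩

variable (E) in
/-- The "compact" operators `𝓚(E)`: the norm closure in `𝓛(E)` of the linear span of the rank one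
operators `θ_{x,y}`. -/
def compacts : Submodule ℂ (adjointable A E) :=
  (Submodule.span ℂ (Set.range fun p : E × E => rankOne A p.1 p.2)).topologicalClosure

end operators

end

end HilbertMod

/-! Since `A` is finite-dimensional, each `θ_{x,y}` factors through bounded subsets of `A` and is a
compact operator of the Banach space `E`; norm limits stay compact. Right multiplications commute
with the `A`-linear `K`, so a closed subspace invariant under the whole commutant of `K` is an
`A`-submodule invariant under `S`. Lomonosov's theorem provides one, as `E` is infinite-dimensional:
an eigenspace for a nonzero eigenvalue or, when `K` is quasinilpotent, the closed orbit of a vector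
under the commutant (Hilden's argument). -/

open Filter Topology

section lomonosov

variable {X : Type*} [NormedAddCommGroup X] [NormedSpace ℂ X]

/-- A quasinilpotent element has powers decaying faster than any geometric sequence. -/
theorem exists_pow_mul_norm_pow_lt_of_spectralRadius_eq_zero {R : Type*} [NormedRing R]
    [NormedAlgebra ℂ R] [CompleteSpace R] {a : R} (ha : spectralRadius ℂ a = 0) {c δ : ℝ}
    (hc : 0 ≤ c) (hδ : 0 < δ) : ∃ n : ℕ, c ^ n * ‖a ^ n‖ < δ := by
  have hlim := spectrum.pow_norm_pow_one_div_tendsto_nhds_spectralRadius a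
  rw [ha] at hlim
  -- With this bound on the `n`-th root, `c ^ n * ‖a ^ n‖ ≤ (1 / 2) ^ n`; the `+ 1` covers `c = 0`.
  have hε : 0 < 1 / (2 * (c + 1)) := by positivity
  have hsmall : ∀ᶠ n : ℕ in atTop, (1 / 2 : ℝ) ^ n < δ :=
    (tendsto_pow_atTop_nhds_zero_of_lt_one (by norm_num) (by norm_num)).eventually_lt_const hδ
  obtain ⟨n, hn, hnδ, hn0⟩ := ((hlim.eventually_lt_const (ENNReal.ofReal_pos.2 hε)).and
    (hsmall.and (eventually_gt_atTop 0))).exists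
  refine ⟨n, lt_of_le_of_lt ?_ hnδ⟩
  have hroot : ‖a ^ n‖ ^ (1 / n : ℝ) < 1 / (2 * (c + 1)) := (ENNReal.ofReal_lt_ofReal_iff hε).1 hn
  have hpow : ‖a ^ n‖ ≤ (1 / (2 * (c + 1))) ^ n := by
    calc ‖a ^ n‖ = (‖a ^ n‖ ^ (1 / n : ℝ)) ^ n := by
          rw [one_div, Real.rpow_inv_natCast_pow (norm_nonneg _) hn0.ne']
      _ ≤ _ := by gcongr
  calc c ^ n * ‖a ^ n‖ ≤ c ^ n * (1 / (2 * (c + 1))) ^ n := by gcongr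
    _ = (c * (1 / (2 * (c + 1)))) ^ n := (mul_pow _ _ _).symm
    _ ≤ (1 / 2) ^ n := by
      gcongr
      rw [mul_one_div, div_le_div_iff₀ (by positivity) (by positivity)]
      linarith

/-- The closed subspace generated by the orbit of `y` under the commutant of `K`. -/
noncomputable def commutantOrbitClosure (K : X →L[ℂ] X) (y : X) : Submodule ℂ X :=
  ((Subalgebra.centralizer ℂ {K}).toSubmodule.map
    (ContinuousLinearMap.apply ℂ X y).toLinearMap).topologicalClosure

theorem mem_commutantOrbitClosure_self (K : X →L[ℂ] X) (y : X) :
    y ∈ commutantOrbitClosure K y :=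
  Submodule.le_topologicalClosure _ ⟨1, one_mem (Subalgebra.centralizer ℂ {K}), rfl⟩

/-- The commutant is closed under products, so `T` preserves the orbit, and by continuity its
closure. -/
theorem map_mem_commutantOrbitClosure {K T : X →L[ℂ] X} (hT : Commute K T) (y : X) {x : X}
    (hx : x ∈ commutantOrbitClosure K y) : T x ∈ commutantOrbitClosure K y := by
  refine map_mem_closure T.continuous hx ?_
  rintro _ ⟨R, hR, rfl⟩
  refine ⟨T * R, mul_mem (S := Subalgebra ℂ (X →L[ℂ] X)) ?_ hR, rfl⟩
  exact (Subalgebra.mem_centralizer_iff ℂ).2 (by rintro _ rfl; exact hT.eq)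

/-- If the commutant of `K` acts topologically transitively, then every compact set avoiding `0`
can be moved pointwise into a given ball by a bounded family of operators commuting with `K`. -/
theorem exists_bound_commute_mem_ball {K : X →L[ℂ] X}
    (htrans : ∀ y : X, y ≠ 0 → commutantOrbitClosure K y = ⊤) {C : Set X} (hC : IsCompact C)
    (hC0 : (0 : X) ∉ C) (x₀ : X) {r : ℝ} (hr : 0 < r) :
    ∃ c : ℝ, ∀ y ∈ C, ∃ T : X →L[ℂ] X, Commute K T ∧ ‖T‖ ≤ c ∧ T y ∈ Metric.ball x₀ r := by
  refine hC.induction_on (p := fun s => ∃ c : ℝ, ∀ y ∈ s, ∃ T : X →L[ℂ] X, Commute K T ∧ ‖T‖ ≤ c ∧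
    T y ∈ Metric.ball x₀ r) ⟨0, by simp⟩ ?_ ?_ ?_
  · rintro s t hst ⟨c, hc⟩
    exact ⟨c, fun y hy => hc y (hst hy)⟩
  · rintro s t ⟨c, hc⟩ ⟨d, hd⟩
    refine ⟨max c d, ?_⟩
    rintro y (hy | hy)
    · obtain ⟨T, h₁, h₂, h₃⟩ := hc y hy
      exact ⟨T, h₁, h₂.trans (le_max_left _ _), h₃⟩
    · obtain ⟨T, h₁, h₂, h₃⟩ := hd y hy
      exact ⟨T, h₁, h₂.trans (le_max_right _ _), h₃⟩
  · intro y hy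
    have hmem : x₀ ∈ commutantOrbitClosure K y := by
      rw [htrans y (ne_of_mem_of_not_mem hy hC0)]
      trivial
    obtain ⟨_, ⟨T, hT, rfl⟩, hdist⟩ := Metric.mem_closure_iff.1 hmem r hr
    -- One `T` serves a whole neighbourhood of `y`; compactness leaves finitely many norms to bound.
    refine ⟨T ⁻¹' Metric.ball x₀ r, mem_nhdsWithin_of_mem_nhds ?_, ‖T‖, fun z hz => ⟨T, ?_, le_rfl, hz⟩⟩
    · refine (Metric.isOpen_ball.preimage T.continuous).mem_nhds ?_
      rw [Set.mem_preimage, Metric.mem_ball, dist_comm]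
      exact hdist
    · exact (Subalgebra.mem_centralizer_iff ℂ).1 hT K rfl

/-- A nonzero quasinilpotent compact operator has a commutant that is not topologically
transitive (Hilden's argument). -/
theorem exists_commutantOrbitClosure_ne_top [CompleteSpace X] {K : X →L[ℂ] X} (hK : IsCompactOperator K)
    (hK0 : K ≠ 0) (hrad : spectralRadius ℂ K = 0) :
    ∃ y : X, y ≠ 0 ∧ commutantOrbitClosure K y ≠ ⊤ := by
  by_contra! htrans
  obtain ⟨x₀, hx₀⟩ : ∃ x₀, K x₀ ≠ 0 := by
    by_contra! h
    exact hK0 (ContinuousLinearMap.ext h)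
  obtain ⟨r, hr, hball⟩ : ∃ r > 0, ∀ x ∈ Metric.closedBall x₀ r, ‖K x₀‖ / 2 < ‖K x‖ := by
    have hev : ∀ᶠ x in 𝓝 x₀, ‖K x₀‖ / 2 < ‖K x‖ :=
      K.continuous.norm.continuousAt.eventually_const_lt (half_lt_self (norm_pos_iff.2 hx₀))
    exact Metric.nhds_basis_closedBall.eventually_iff.1 hev
  have hC : IsCompact (closure (K '' Metric.closedBall x₀ r)) :=
    hK.isCompact_closure_image_of_bounded (f := (K : X →ₗ[ℂ] X)) Metric.isBounded_closedBall
  have hC0 : (0 : X) ∉ closure (K '' Metric.closedBall x₀ r) := by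
    intro h0
    have hsub : closure (K '' Metric.closedBall x₀ r) ⊆ {y | ‖K x₀‖ / 2 ≤ ‖y‖} := by
      refine closure_minimal ?_ (isClosed_le continuous_const continuous_norm)
      rintro _ ⟨x, hx, rfl⟩
      exact (hball x hx).le
    have := hsub h0
    simp only [Set.mem_ofPred_eq, norm_zero] at this
    linarith [norm_pos_iff.2 hx₀]
  obtain ⟨c, hc⟩ := exists_bound_commute_mem_ball htrans hC hC0 x₀ hr
  have hc0 : 0 ≤ c := by
    obtain ⟨T, -, hT, -⟩ := hc (K x₀) (subset_closure ⟨x₀, Metric.mem_closedBall_self hr.le, rfl⟩)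
    exact (norm_nonneg T).trans hT
  -- Alternate `K` with operators that bring its values back into the ball; commutation collects all
  -- factors `K` on the right.
  have hiter : ∀ n : ℕ, ∃ T : X →L[ℂ] X, Commute K T ∧ ‖T‖ ≤ c ^ n ∧
      T ((K ^ n) x₀) ∈ Metric.ball x₀ r := by
    intro n
    induction n with
    | zero =>
      exact ⟨1, Commute.one_right K, ContinuousLinearMap.norm_id_le.trans_eq (pow_zero c).symm,
        by simpa using hr⟩
    | succ n ih =>
      obtain ⟨T, hTK, hTn, hTx⟩ := ih
      obtain ⟨R, hRK, hRn, hRx⟩ := hc (K (T ((K ^ n) x₀)))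
        (subset_closure ⟨_, Metric.ball_subset_closedBall hTx, rfl⟩)
      refine ⟨R * T, hRK.mul_right hTK, ?_, ?_⟩
      · rw [pow_succ']
        exact (norm_mul_le _ _).trans (by gcongr)
      · have hKT : K (T ((K ^ n) x₀)) = T ((K ^ (n + 1)) x₀) := by
          rw [pow_succ']
          exact DFunLike.congr_fun hTK.eq ((K ^ n) x₀)
        rw [hKT] at hRx
        exact hRx
  have hKnorm : 0 < ‖K‖ := norm_pos_iff.2 hK0
  have hx₀norm : 0 < ‖x₀‖ := norm_pos_iff.2 fun h => hx₀ (by simp [h])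
  -- This `δ` makes `‖K (T (K ^ n x₀))‖ ≤ ‖K x₀‖ / 2`, against the lower bound `hball`.
  obtain ⟨n, hn⟩ := exists_pow_mul_norm_pow_lt_of_spectralRadius_eq_zero hrad hc0
    (δ := ‖K x₀‖ / 2 / (‖K‖ * ‖x₀‖)) (by have := norm_pos_iff.2 hx₀; positivity)
  obtain ⟨T, -, hTn, hTx⟩ := hiter n
  rw [lt_div_iff₀ (by positivity)] at hn
  refine (hball _ (Metric.ball_subset_closedBall hTx)).not_ge ?_
  calc ‖K (T ((K ^ n) x₀))‖ ≤ ‖K‖ * (‖T‖ * (‖K ^ n‖ * ‖x₀‖)) :=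
        K.le_opNorm_of_le (T.le_opNorm_of_le ((K ^ n).le_opNorm x₀))
    _ ≤ ‖K‖ * (c ^ n * (‖K ^ n‖ * ‖x₀‖)) := by gcongr
    _ = c ^ n * ‖K ^ n‖ * (‖K‖ * ‖x₀‖) := by ring
    _ ≤ ‖K x₀‖ / 2 := hn.le

/-- **Lomonosov's theorem** for a single compact operator: a nonzero compact operator on an
infinite-dimensional complex Banach space has a nontrivial closed hyperinvariant subspace. -/
theorem exists_hyperinvariant_of_isCompactOperator [CompleteSpace X]
    (hX : ¬ FiniteDimensional ℂ X) {K : X →L[ℂ] X} (hK : IsCompactOperator K) (hK0 : K ≠ 0) :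
    ∃ W : Submodule ℂ X, IsClosed (W : Set X) ∧ W ≠ ⊥ ∧ W ≠ ⊤ ∧
      ∀ T : X →L[ℂ] X, Commute K T → ∀ x ∈ W, T x ∈ W := by
  by_cases hev : ∃ μ : ℂ, μ ≠ 0 ∧ Module.End.HasEigenvalue (K : Module.End ℂ X) μ
  · obtain ⟨μ, hμ, heig⟩ := hev
    have hmem : ∀ x, x ∈ Module.End.eigenspace (K : Module.End ℂ X) μ ↔ K x = μ • x :=
      fun x => Module.End.mem_eigenspace_iff
    refine ⟨Module.End.eigenspace (K : Module.End ℂ X) μ, ?_, heig, ?_, ?_⟩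
    · have hset : (Module.End.eigenspace (K : Module.End ℂ X) μ : Set X) = {x | K x = μ • x} :=
        Set.ext hmem
      rw [hset]
      exact isClosed_eq K.continuous (continuous_const_smul μ)
    · intro htop
      -- If the eigenspace were everything, the identity `μ⁻¹ • K` would be compact.
      refine hX (FiniteDimensional.of_isCompactOperator_id (𝕜 := ℂ) ?_)
      have hid : (id : X → X) = μ⁻¹ • ⇑K := by
        funext x
        have hx : K x = μ • x := (hmem x).1 (htop ▸ Submodule.mem_top)
        simp [hx, hμ]
      rw [hid]
      exact hK.smul μ⁻¹
    · intro T hT x hx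
      rw [hmem] at hx ⊢
      have hcomm : K (T x) = T (K x) := DFunLike.congr_fun hT.eq x
      rw [hcomm, hx, map_smul]
  · push Not at hev
    have hrad : spectralRadius ℂ K = 0 := by
      refine le_antisymm (iSup₂_le fun μ hμ => ?_) bot_le
      -- By the Fredholm alternative, a nonzero spectral value would be an eigenvalue.
      by_cases h0 : μ = 0
      · simp [h0]
      · exact absurd ((IsCompactOperator.hasEigenvalue_iff_mem_spectrum hK h0).2 hμ) (hev μ h0)
    obtain ⟨y, hy, hne⟩ := exists_commutantOrbitClosure_ne_top hK hK0 hrad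
    exact ⟨commutantOrbitClosure K y, Submodule.isClosed_topologicalClosure _,
      fun h => hy ((Submodule.eq_bot_iff _).1 h y (mem_commutantOrbitClosure_self K y)), hne,
      fun T hT x hx => map_mem_commutantOrbitClosure hT y hx⟩

end lomonosov

namespace HilbertMod

theorem isFinitelyGenerated_of_finiteDimensional (A : Type*) {E : Type*} [NormedAddCommGroup E]
    [NormedSpace ℂ E] [SMul Aᵐᵒᵖ E] [FiniteDimensional ℂ E] : IsFinitelyGenerated A E := by
  obtain ⟨s, hs⟩ := (Module.finite_def (R := ℂ) (M := E)).1 inferInstance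
  exact ⟨s, fun W _ hsW => top_unique (hs ▸ Submodule.span_le.2 hsW)⟩

section

variable {A : Type*} [NonUnitalCStarAlgebra A] [PartialOrder A]
  {E : Type*} [NormedAddCommGroup E] [NormedSpace ℂ E] [SMul Aᵐᵒᵖ E] [CStarModule Aᵐᵒᵖ E]

variable (E) in
/-- Right multiplication by an element of `A`, as a bounded operator. -/
noncomputable def actionCLM (a : A) : E →L[ℂ] E :=
  LinearMap.mkContinuous
    { toFun := fun x => op a • x
      map_add' := action_add a
      map_smul' := fun c x => action_smul c a x }
    ‖a‖ fun x => (norm_action_le A a x).trans_eq (mul_comm _ _)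

/-- The map `a ↦ x a`. -/
def actionLinearMap (x : E) : A →ₗ[ℂ] E where
  toFun a := op a • x
  map_add' a b := add_action a b x
  map_smul' c a := smul_action c a x

theorem isCompactOperator_rankOne [StarOrderedRing A] [FiniteDimensional ℂ A] (x y : E) :
    IsCompactOperator (rankOne A x y : E →L[ℂ] E) := by
  have hbound : ∀ z ∈ Metric.ball (0 : E) 1, ip A y z ∈ Metric.closedBall (0 : A) ‖y‖ := by
    intro z hz
    rw [mem_ball_zero_iff] at hz
    rw [mem_closedBall_zero_iff]
    exact (norm_ip_le A y z).trans (mul_le_of_le_one_right (norm_nonneg y) hz.le)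
  have : ProperSpace A := FiniteDimensional.proper ℂ A
  refine ⟨actionLinearMap x '' Metric.closedBall (0 : A) ‖y‖,
    (isCompact_closedBall 0 ‖y‖).image (actionLinearMap x).continuous_of_finiteDimensional, ?_⟩
  filter_upwards [Metric.ball_mem_nhds (0 : E) one_pos] with z hz
  exact ⟨ip A y z, hbound z hz, rfl⟩

theorem isCompactOperator_of_mem_compacts [StarOrderedRing A] [FiniteDimensional ℂ A]
    [CompleteSpace E] {K : adjointable A E} (hK : K ∈ compacts A E) :
    IsCompactOperator (K : E →L[ℂ] E) := by
  have hle : compacts A E ≤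
      (compactOperator (RingHom.id ℂ) E E).comap
        ((adjointable A E).val.toLinearMap) := by
    refine Submodule.topologicalClosure_minimal _ (Submodule.span_le.2 ?_) ?_
    · rintro _ ⟨p, rfl⟩
      exact isCompactOperator_rankOne p.1 p.2
    · exact isClosed_setOfPred_isCompactOperator.preimage continuous_subtype_val
  exact hle hK

theorem exists_invariantSubmodule_of_commute [StarOrderedRing A] [FiniteDimensional ℂ A]
    [CompleteSpace E] (hE : ¬ IsFinitelyGenerated A E) {S K : adjointable A E}
    (hK : K ∈ compacts A E) (hK0 : K ≠ 0) (hSK : S * K = K * S) :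
    ∃ W : Submodule ℂ E, IsInvariantSubmodule A S W ∧ W ≠ ⊥ ∧ W ≠ ⊤ := by
  obtain ⟨W, hclosed, hbot, htop, hinv⟩ := exists_hyperinvariant_of_isCompactOperator
    (fun _ => hE (isFinitelyGenerated_of_finiteDimensional A))
    (isCompactOperator_of_mem_compacts hK) (fun h => hK0 (Subtype.ext h))
  refine ⟨W, ⟨fun a x hx => hinv (actionCLM E a) ?_ x hx, hclosed, hinv S ?_⟩, hbot, htop⟩
  · exact ContinuousLinearMap.ext fun x => K.2.1 a x
  · exact congrArg Subtype.val hSK.symm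

end

end HilbertMod

theorem mainTheorem2 {A : Type*} [NonUnitalCStarAlgebra A] [PartialOrder A] [StarOrderedRing A]
    [FiniteDimensional ℂ A]
    {E : Type*} [NormedAddCommGroup E] [NormedSpace ℂ E] [CompleteSpace E]
    [SMul Aᵐᵒᵖ E] [CStarModule Aᵐᵒᵖ E]
    (hE : ¬ HilbertMod.IsFinitelyGenerated A E) :
    (∀ S K : HilbertMod.adjointable A E, K ∈ HilbertMod.compacts A E → K ≠ 0 → S * K = K * S →
      ∃ W : Submodule ℂ E, HilbertMod.IsInvariantSubmodule A S W ∧ W ≠ ⊥ ∧ W ≠ ⊤) ∧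
    (∀ K : HilbertMod.adjointable A E, K ∈ HilbertMod.compacts A E → K ≠ 0 →
      ∃ W : Submodule ℂ E, HilbertMod.IsInvariantSubmodule A K W ∧ W ≠ ⊥ ∧ W ≠ ⊤) := by
  exact ⟨fun S K hK hK0 hSK => HilbertMod.exists_invariantSubmodule_of_commute hE hK hK0 hSK,
    fun K hK hK0 => HilbertMod.exists_invariantSubmodule_of_commute hE hK hK0 rfl⟩
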